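/- For every $\varepsilon>0$, the real Hilbert space $L_2(\mathbb R)$ (real-valued square-integrable functions on $\mathbb R$ with Lebesgue measure, modulo almost everywhere equality) has a Schauder basis $(f_j)_{j=1}^\infty$ such that $f_j\ge 0$ almost everywhere for every $j$ and whose basis constant is at most $1+\varepsilon$. Here $(f_j)_{j=1}^\infty$ is a Schauder basis if every $f\in L_2(\mathbb R)$ has a unique expansion $f=\sum_{j=1}^\infty a_jf_j$, with real scalars $a_j$ and convergence of the partial sums in norm; its basis constant is the least $C>0$ such that $\bigl\|\sum_{j=1}^m a_jf_j\bigr\|\le C\,\bigl\|\sum_{j=1}^n a_jf_j\bigr\|$ for all $m\le n$ and all real scalars $a_1,\dots,a_n$. -/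

import Mathlib

open MeasureTheory

/-- A sequence `x` in a normed space is `C`-basic: `C > 0` and, for all `m ≤ n` and all scalars,
the norm of the `m`-th partial sum is at most `C` times the norm of the `n`-th one. -/
def IsCBasic (𝕜 : Type*) {X : Type*} [NontriviallyNormedField 𝕜] [NormedAddCommGroup X]
    [NormedSpace 𝕜 X] (C : ℝ) (x : ℕ → X) : Prop :=
  0 < C ∧ ∀ m n : ℕ, m ≤ n → ∀ a : ℕ → 𝕜,
    ‖∑ j ∈ Finset.range m, a j • x j‖ ≤ C * ‖∑ j ∈ Finset.range n, a j • x j‖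

/-- `C` is the basis constant of the sequence `x`: the least constant for which `x` is
`C`-basic. -/
def IsBasisConstant (𝕜 : Type*) {X : Type*} [NontriviallyNormedField 𝕜] [NormedAddCommGroup X]
    [NormedSpace 𝕜 X] (C : ℝ) (x : ℕ → X) : Prop :=
  IsLeast {K : ℝ | IsCBasic 𝕜 K x} C

open Filter Topology

/-! ### Basic sequences and Schauder bases in a normed space -/

section BasicSequence

variable {X : Type*} [NormedAddCommGroup X] [NormedSpace ℝ X]

/-! The basis is built in finite blocks, each bringing one target function closer to the span. Let
`F` be the span so far and `h` the normalized residual of the target, orthogonal to `F`. Since `h`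
may change sign, the new vectors are y_j = d_j + c((-1)^j h + |h|), where the d_j are nonnegative
and orthogonal to `F`, `h` and `|h|`. An alternating combination of the y_j accumulates `h` and
cancels `|h|`.

This requires d_1, ..., d_N, with N a power of 2, on which the functional Σ (-1)^j x_j has norm at
most √N while Σ x_j has norm smaller by a factor exponential in log N, with partial sum projections
of norm close to 1. Such systems come from a dyadic tree: two copies of a system are joined by
adding one small common vector (`IsDyadicSystem.glue`). The common vectors penalize Σ x_j and vanish
on alternating sums.

With c = δ/√N the `|h|` terms are a small relative error, the block is almost orthogonal to `F`, and
the squared distance to `h` is at most 1/(1 + δ²) (`exists_nonneg_extension`). By almost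
orthogonality, appending a block essentially takes the maximum of the two projection constants, not
their product (`IsNonnegSystem.exists_extension`). Treating each member of a dense sequence
infinitely often makes the span dense, and `IsCBasic.exists_schauderBasis` concludes. -/

theorem sum_range_ite_smul {m n : ℕ} (h : m ≤ n) (a : ℕ → ℝ) (x : ℕ → X) :
    ∑ j ∈ Finset.range n, (if j < m then a j else 0) • x j =
      ∑ j ∈ Finset.range m, a j • x j := by
  rw [← Finset.sum_subset (Finset.range_mono h)]
  · refine Finset.sum_congr rfl fun j hj => ?_
    rw [if_pos (Finset.mem_range.1 hj)]
  · intro j _ hj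
    rw [if_neg (by simpa using hj), zero_smul]

theorem exists_finsupp_linearCombination_eq_sum_range (x : ℕ → X) (c : ℕ →₀ ℝ) :
    ∃ n, (∀ i, c i ≠ 0 → i < n) ∧
      Finsupp.linearCombination ℝ x c = ∑ j ∈ Finset.range n, c j • x j := by
  have hlt : ∀ i, c i ≠ 0 → i < c.support.sup id + 1 := fun i hi =>
    Nat.lt_succ_of_le (Finset.le_sup (f := id) (Finsupp.mem_support_iff.2 hi))
  refine ⟨c.support.sup id + 1, hlt, ?_⟩
  rw [Finsupp.linearCombination_apply, Finsupp.sum]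
  apply Finset.sum_subset
  · exact fun i hi => Finset.mem_range.2 (hlt i (Finsupp.mem_support_iff.1 hi))
  · intro i _ hi
    rw [Finsupp.notMem_support_iff.1 hi, zero_smul]

/-- Each term is a difference of two consecutive partial sums. This yields both linear independence
and continuity of the coordinate functionals. -/
theorem IsCBasic.abs_mul_norm_le {C : ℝ} {x : ℕ → X} (h : IsCBasic ℝ C x) (a : ℕ → ℝ) {i n : ℕ}
    (hi : i < n) : |a i| * ‖x i‖ ≤ 2 * C * ‖∑ j ∈ Finset.range n, a j • x j‖ := by
  have h1 := h.2 i n hi.le a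
  have h2 := h.2 (i + 1) n hi a
  rw [← Real.norm_eq_abs, ← norm_smul]
  have : a i • x i = ∑ j ∈ Finset.range (i + 1), a j • x j - ∑ j ∈ Finset.range i, a j • x j := by
    rw [Finset.sum_range_succ]; abel
  rw [this]
  linarith [norm_sub_le (∑ j ∈ Finset.range (i + 1), a j • x j) (∑ j ∈ Finset.range i, a j • x j)]

theorem IsCBasic.linearIndependent {C : ℝ} {x : ℕ → X} (h : IsCBasic ℝ C x)
    (hx : ∀ n, x n ≠ 0) : LinearIndependent ℝ x := by
  rw [linearIndependent_iff]
  intro l hl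
  obtain ⟨n, hn, hsum⟩ := exists_finsupp_linearCombination_eq_sum_range x l
  ext i
  by_contra hi
  have := h.abs_mul_norm_le l (hn i hi)
  rw [← hsum, hl, norm_zero, mul_zero] at this
  have h1 := norm_pos_iff.2 (hx i)
  have h2 : 0 < |l i| := abs_pos.2 hi
  nlinarith [mul_pos h2 h1]

/-- The least constant exists as soon as some constant does. -/
theorem IsCBasic.exists_isBasisConstant {K : ℝ} {x : ℕ → X} (h : IsCBasic ℝ K x)
    (hx : x 0 ≠ 0) : ∃ C, IsBasisConstant ℝ C x ∧ C ≤ K := by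
  have one_le : ∀ L ∈ {L : ℝ | IsCBasic ℝ L x}, 1 ≤ L := by
    intro L hL
    have := hL.2 1 1 le_rfl (fun _ => 1)
    simp only [Finset.sum_range_one, one_smul] at this
    exact (le_mul_iff_one_le_left (norm_pos_iff.2 hx)).1 this
  have hb : BddBelow {L : ℝ | IsCBasic ℝ L x} := ⟨1, one_le⟩
  refine ⟨sInf {L : ℝ | IsCBasic ℝ L x}, ⟨⟨?_, ?_⟩, fun L hL => csInf_le hb hL⟩, csInf_le hb h⟩
  · exact zero_lt_one.trans_le (le_csInf ⟨K, h⟩ one_le)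
  · intro m n hmn a
    -- The infimum is attained: if the long sum vanishes, so does the short one; otherwise every
    -- admissible constant is at least the quotient of the norms, hence so is the infimum.
    rcases eq_or_ne (∑ j ∈ Finset.range n, a j • x j) 0 with h0 | h0
    · have := h.2 m n hmn a
      rw [h0] at this ⊢
      simpa using this
    · have hpos := norm_pos_iff.2 h0
      rw [← div_le_iff₀ hpos]
      exact le_csInf ⟨K, h⟩ fun L hL => (div_le_iff₀ hpos).2 (hL.2 m n hmn a)

theorem mem_span_range_iff_exists_sum_range {x : ℕ → X} {v : X} :
    v ∈ Submodule.span ℝ (Set.range x) ↔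
      ∃ (n : ℕ) (a : ℕ → ℝ), ∑ j ∈ Finset.range n, a j • x j = v := by
  constructor
  · intro hv
    obtain ⟨c, rfl⟩ := Finsupp.mem_span_range_iff_exists_finsupp.1 hv
    obtain ⟨n, -, hn⟩ := exists_finsupp_linearCombination_eq_sum_range x c
    exact ⟨n, c, hn.symm⟩
  · rintro ⟨n, a, rfl⟩
    exact Submodule.sum_mem _ fun j _ =>
      Submodule.smul_mem _ _ (Submodule.subset_span (Set.mem_range_self j))

/-- A sequence of nonzero vectors with uniformly bounded partial sum projections and dense span
is a Schauder basis. -/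
theorem IsCBasic.exists_schauderBasis {C : ℝ} {x : ℕ → X} (h : IsCBasic ℝ C x)
    (hx : ∀ n, x n ≠ 0) (hd : Dense (Submodule.span ℝ (Set.range x) : Set X)) :
    ∃ b : SchauderBasis ℝ X, b.basis = x := by
  have hli := h.linearIndependent hx
  let S := Submodule.span ℝ (Set.range x)
  let B : Module.Basis ℕ ℝ S := Module.Basis.span hli
  have hB : ∀ i, (B i : X) = x i := fun i =>
    congrArg Subtype.val (Module.Basis.span_apply hli i)
  have hrepr : ∀ (v : S) (n : ℕ) (a : ℕ → ℝ), ∑ j ∈ Finset.range n, a j • x j = v →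
      ∀ i, B.coord i v = if i < n then a i else 0 := by
    intro v n a hv i
    have : v = ∑ j ∈ Finset.range n, a j • B j := by
      apply Subtype.ext
      simp [← hv, hB]
    rw [this]
    simp [Finsupp.single_apply]
  have hbound : ∀ i (v : S), ‖B.coord i v‖ ≤ (2 * C / ‖x i‖) * ‖v‖ := by
    intro i v
    obtain ⟨n, a, hv⟩ := mem_span_range_iff_exists_sum_range.1 v.2
    rw [hrepr v n a hv i]
    split_ifs with hi
    · have := h.abs_mul_norm_le a hi
      rw [hv] at this
      rw [div_mul_eq_mul_div, le_div_iff₀ (norm_pos_iff.2 (hx i))]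
      exact this
    · have := h.1
      rw [norm_zero]
      positivity
  -- The coordinates are bounded on the span and extend to the whole space by Hahn–Banach.
  choose φ hφ using fun i => exists_extension_norm_eq (𝕜 := ℝ) S
    ((B.coord i).mkContinuous (2 * C / ‖x i‖) (hbound i))
  have hφ' : ∀ i (v : S), φ i v = B.coord i v := fun i v => (hφ i).1 v
  have hP : ∀ (n : ℕ) (v : X), ‖∑ i ∈ Finset.range n, φ i v • x i‖ ≤ C * ‖v‖ := by
    intro n
    have hcl : IsClosed {v : X | ‖∑ i ∈ Finset.range n, φ i v • x i‖ ≤ C * ‖v‖} :=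
      isClosed_le (by fun_prop) (by fun_prop)
    suffices (S : Set X) ⊆ {v : X | ‖∑ i ∈ Finset.range n, φ i v • x i‖ ≤ C * ‖v‖} by
      intro v
      have h1 := hcl.closure_subset_iff.2 this
      rw [hd.closure_eq] at h1
      exact h1 (Set.mem_univ v)
    intro v hv
    obtain ⟨k, a, hv'⟩ := mem_span_range_iff_exists_sum_range.1 hv
    -- The representation of `v` may have fewer than `n` terms, so it is padded with zeros.
    have h1 := h.2 n (max n k) (le_max_left _ _) (fun i => if i < k then a i else 0)
    have h2 : ∑ j ∈ Finset.range (max n k), (if j < k then a j else 0) • x j = v := by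
      rw [sum_range_ite_smul (le_max_right n k), hv']
    rw [h2] at h1
    refine le_of_eq_of_le ?_ h1
    congr 1
    refine Finset.sum_congr rfl fun i _ => ?_
    rw [← hrepr ⟨v, hv⟩ k a hv' i, ← hφ' i ⟨v, hv⟩]
  refine ⟨⟨x, φ, ?_, ?_⟩, rfl⟩
  · intro i j
    have := hφ' i (B j)
    rw [hB] at this
    rw [this]
    simp [Finsupp.single_apply, Pi.single_apply, eq_comm]
  · intro v
    rw [HasSum, SummationFilter.conditional_filter_eq_map_range, tendsto_map'_iff]
    rw [Metric.tendsto_atTop]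
    intro r hr
    have hC := h.1
    obtain ⟨w, hw, hvw⟩ := Metric.mem_closure_iff.1 (hd v) (r / (C + 1)) (by positivity)
    obtain ⟨k, a, hw'⟩ := mem_span_range_iff_exists_sum_range.1 hw
    -- From index `k` on, the partial sum projections fix `w`, so the error at `v` equals the error
    -- at `v - w`, at most `(C + 1) * ‖v - w‖`.
    refine ⟨k, fun n hn => ?_⟩
    have h1 : ∑ i ∈ Finset.range n, φ i w • x i = w := by
      conv_rhs => rw [← hw', ← sum_range_ite_smul hn]
      refine Finset.sum_congr rfl fun j _ => ?_
      rw [hφ' j ⟨w, hw⟩, hrepr ⟨w, hw⟩ k a hw' j]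
    have h2 : ∑ i ∈ Finset.range n, φ i v • x i - v =
        ∑ i ∈ Finset.range n, φ i (v - w) • x i - (v - w) := by
      simp only [map_sub, sub_smul, Finset.sum_sub_distrib, h1]
      abel
    simp only [Function.comp]
    rw [dist_eq_norm, h2]
    rw [dist_eq_norm] at hvw
    calc _ ≤ C * ‖v - w‖ + ‖v - w‖ := (norm_sub_le _ _).trans (by gcongr; exact hP n _)
      _ = ‖v - w‖ * (C + 1) := by ring
      _ < r := (lt_div_iff₀ (by positivity)).1 hvw

end BasicSequence

/-! ### Functions vanishing far to the right, and fresh unit vectors orthogonal to them -/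

/-- The functions in `L²(ℝ)` vanishing on `[K, ∞)`. -/
def vanishingAbove (K : ℕ) : Submodule ℝ (Lp ℝ 2 (volume : Measure ℝ)) where
  carrier := {f | ∀ᵐ t : ℝ, (K : ℝ) ≤ t → f t = 0}
  zero_mem' := by
    filter_upwards [Lp.coeFn_zero ℝ 2 (volume : Measure ℝ)] with t ht _
    rw [ht]; rfl
  add_mem' := by
    intro f g hf hg
    filter_upwards [hf, hg, Lp.coeFn_add f g] with t h1 h2 h3 ht
    rw [h3, Pi.add_apply, h1 ht, h2 ht, add_zero]
  smul_mem' := by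
    intro c f hf
    filter_upwards [hf, Lp.coeFn_smul c f] with t h1 h2 ht
    rw [h2, Pi.smul_apply, h1 ht, smul_zero]

theorem mem_vanishingAbove {K : ℕ} {f : Lp ℝ 2 (volume : Measure ℝ)} :
    f ∈ vanishingAbove K ↔ ∀ᵐ t : ℝ, (K : ℝ) ≤ t → f t = 0 := Iff.rfl

theorem vanishingAbove_mono : Monotone vanishingAbove := by
  intro K L hKL f hf
  filter_upwards [mem_vanishingAbove.1 hf] with t h ht
  exact h (le_trans (by exact_mod_cast hKL) ht)

theorem abs_mem_vanishingAbove {K : ℕ} {f : Lp ℝ 2 (volume : Measure ℝ)}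
    (hf : f ∈ vanishingAbove K) : |f| ∈ vanishingAbove K := by
  rw [mem_vanishingAbove] at hf ⊢
  filter_upwards [hf, Lp.coeFn_abs f] with t h1 h2 ht
  rw [h2, h1 ht, abs_zero]

theorem dense_iUnion_vanishingAbove :
    Dense (⋃ K, (vanishingAbove K : Set (Lp ℝ 2 (volume : Measure ℝ)))) := by
  intro f
  rw [Metric.mem_closure_iff]
  intro r hr
  obtain ⟨g, hg, hfg, -, hgm⟩ := (Lp.memLp f).exists_hasCompactSupport_eLpNorm_sub_le
    (by norm_num) (ε := ENNReal.ofReal (r / 2)) (by simpa using hr)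
  obtain ⟨R, hR⟩ := hg.isCompact.isBounded.subset_closedBall 0
  obtain ⟨K, hK⟩ := exists_nat_gt R
  refine ⟨hgm.toLp g, Set.mem_iUnion.2 ⟨K, ?_⟩, ?_⟩
  · rw [SetLike.mem_coe, mem_vanishingAbove]
    filter_upwards [hgm.coeFn_toLp] with t ht hKt
    rw [ht]
    by_contra hne
    have := hR (subset_tsupport g hne)
    rw [Metric.mem_closedBall, dist_zero_right, Real.norm_eq_abs] at this
    linarith [le_abs_self t]
  · rw [dist_edist, Lp.edist_def]
    have : eLpNorm (⇑f - ⇑(hgm.toLp g)) 2 volume ≤ ENNReal.ofReal (r / 2) := by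
      refine le_of_eq_of_le (eLpNorm_congr_ae ?_) hfg
      filter_upwards [hgm.coeFn_toLp] with t ht
      simp [ht]
    refine (ENNReal.toReal_mono ENNReal.ofReal_ne_top this).trans_lt ?_
    rw [ENNReal.toReal_ofReal (by positivity)]
    linarith

/-- The indicator function of `[k, k + 1)` as an element of `L²(ℝ)`. -/
noncomputable def unitStep (k : ℕ) : Lp ℝ 2 (volume : Measure ℝ) :=
  indicatorConstLp 2 (measurableSet_Ico (a := (k : ℝ)) (b := k + 1)) (by simp) 1

theorem coeFn_unitStep (k : ℕ) :
    unitStep k =ᵐ[volume] (Set.Ico (k : ℝ) (k + 1)).indicator fun _ => (1 : ℝ) :=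
  indicatorConstLp_coeFn

theorem unitStep_nonneg (k : ℕ) : 0 ≤ unitStep k := by
  rw [← Lp.coeFn_nonneg]
  filter_upwards [coeFn_unitStep k] with t ht
  rw [ht]
  exact Set.indicator_nonneg (fun _ _ => zero_le_one) t

theorem unitStep_mem (k : ℕ) : unitStep k ∈ vanishingAbove (k + 1) := by
  rw [mem_vanishingAbove]
  filter_upwards [coeFn_unitStep k] with t ht hk
  rw [ht, Set.indicator_of_notMem]
  push_cast at hk
  exact fun h => not_lt.2 hk h.2

theorem norm_unitStep (k : ℕ) : ‖unitStep k‖ = 1 := by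
  rw [unitStep, norm_indicatorConstLp (by norm_num) (by norm_num)]
  simp

theorem inner_unitStep {k : ℕ} {f : Lp ℝ 2 (volume : Measure ℝ)} (hf : f ∈ vanishingAbove k) :
    inner ℝ f (unitStep k) = 0 := by
  rw [L2.inner_def]
  apply integral_eq_zero_of_ae
  filter_upwards [mem_vanishingAbove.1 hf, coeFn_unitStep k] with t h1 h2
  by_cases ht : (k : ℝ) ≤ t
  · simp [h1 ht]
  · rw [h2, Set.indicator_of_notMem (fun h => ht h.1), inner_zero_right]
    rfl

theorem Lp_smul_nonneg {c : ℝ} (hc : 0 ≤ c) {f : Lp ℝ 2 (volume : Measure ℝ)} (hf : 0 ≤ f) :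
    0 ≤ c • f := by
  rw [← Lp.coeFn_nonneg] at hf ⊢
  filter_upwards [hf, Lp.coeFn_smul c f] with t h1 h2
  rw [h2]
  exact mul_nonneg hc h1

/-! ### Concatenation of two finite systems with a common added vector -/

section Glue

variable {X : Type*} [AddCommGroup X] [Module ℝ X]

/-- The concatenation of `y 0, …, y (N - 1)` and `z`, with `v` added to every vector. -/
def glue (N : ℕ) (y z : ℕ → X) (v : X) (j : ℕ) : X :=
  (if j < N then y j else z (j - N)) + v

theorem sum_glue_of_le {N M : ℕ} (h : M ≤ N) (y z : ℕ → X) (v : X) (x : ℕ → ℝ) :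
    ∑ j ∈ Finset.range M, x j • glue N y z v j =
      ∑ j ∈ Finset.range M, x j • y j + (∑ j ∈ Finset.range M, x j) • v := by
  rw [Finset.sum_smul, ← Finset.sum_add_distrib]
  refine Finset.sum_congr rfl fun j hj => ?_
  rw [glue, if_pos ((Finset.mem_range.1 hj).trans_le h), smul_add]

theorem sum_glue_add (N p : ℕ) (y z : ℕ → X) (v : X) (x : ℕ → ℝ) :
    ∑ j ∈ Finset.range (N + p), x j • glue N y z v j =
      ∑ j ∈ Finset.range N, x j • y j + ∑ j ∈ Finset.range p, x (N + j) • z j +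
        (∑ j ∈ Finset.range N, x j + ∑ j ∈ Finset.range p, x (N + j)) • v := by
  have : ∑ j ∈ Finset.range p, x (N + j) • glue N y z v (N + j) =
      ∑ j ∈ Finset.range p, x (N + j) • z j + (∑ j ∈ Finset.range p, x (N + j)) • v := by
    rw [Finset.sum_smul, ← Finset.sum_add_distrib]
    refine Finset.sum_congr rfl fun j hj => ?_
    rw [glue, if_neg (by omega), Nat.add_sub_cancel_left, smul_add]
  rw [Finset.sum_range_add, this, sum_glue_of_le le_rfl, add_smul]
  abel

end Glue

/-! ### Dyadic systems -/

/-- `2 ^ n` nonnegative vectors, supported between `K` and `K'`, whose partial sum projections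
have norm close to `1`, such that the alternating sum has norm at most `2 ^ (n / 2)` while the
summing functional `x ↦ ∑ x j` has norm at most `(2 / (1 + η)) ^ (n / 2)`. -/
structure IsDyadicSystem (η : ℝ) (n K K' : ℕ) (y : ℕ → Lp ℝ 2 (volume : Measure ℝ)) : Prop where
  le : K ≤ K'
  nonneg : ∀ j, 0 ≤ y j
  mem : ∀ j, y j ∈ vanishingAbove K'
  inner_eq : ∀ f ∈ vanishingAbove K, ∀ j, inner ℝ f (y j) = 0
  sum_sq_le : ∀ x : ℕ → ℝ, ((1 + η) / 2) ^ n * (∑ j ∈ Finset.range (2 ^ n), x j) ^ 2 ≤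
    ‖∑ j ∈ Finset.range (2 ^ n), x j • y j‖ ^ 2
  partial_le : ∀ x : ℕ → ℝ, ∀ M ≤ 2 ^ n,
    ‖∑ j ∈ Finset.range M, x j • y j‖ ^ 2 +
      3 * η * ((1 + η) / 2) ^ n * (∑ j ∈ Finset.range M, x j) ^ 2 ≤
    (1 + 12 * η) * ‖∑ j ∈ Finset.range (2 ^ n), x j • y j‖ ^ 2
  norm_alternating_le : ‖∑ j ∈ Finset.range (2 ^ n), (-1 : ℝ) ^ j • y j‖ ^ 2 ≤ 2 ^ n
  alternating_sq_le : ∀ x : ℕ → ℝ, (∑ j ∈ Finset.range (2 ^ n), (-1 : ℝ) ^ j * x j) ^ 2 ≤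
    2 ^ n * ‖∑ j ∈ Finset.range (2 ^ n), x j • y j‖ ^ 2

theorem norm_add_add_smul_unitStep_sq {K : ℕ} {a b : Lp ℝ 2 (volume : Measure ℝ)}
    (ha : a ∈ vanishingAbove K) (hb : b ∈ vanishingAbove K) (hab : inner ℝ a b = 0) (c : ℝ) :
    ‖a + b + c • unitStep K‖ ^ 2 = ‖a‖ ^ 2 + ‖b‖ ^ 2 + c ^ 2 := by
  rw [norm_add_sq_real, norm_add_sq_real, hab, inner_smul_right,
    inner_unitStep (Submodule.add_mem _ ha hb), norm_smul, norm_unitStep, Real.norm_eq_abs,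
    mul_one, sq_abs]
  ring

theorem isDyadicSystem_zero {η : ℝ} (hη : 0 ≤ η) (K : ℕ) :
    IsDyadicSystem η 0 K (K + 1) fun _ => unitStep K where
  le := K.le_succ
  nonneg _ := unitStep_nonneg K
  mem _ := unitStep_mem K
  inner_eq f hf _ := inner_unitStep hf
  sum_sq_le x := by simp [norm_smul, norm_unitStep]
  partial_le x M hM := by
    have hM' : M = 0 ∨ M = 1 := by simp at hM; omega
    rcases hM' with rfl | rfl
    · simp only [Finset.range_zero, Finset.sum_empty]
      norm_num
      positivity
    · simp [norm_smul, norm_unitStep]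
      nlinarith [sq_nonneg (x 0)]
  norm_alternating_le := by simp [norm_unitStep]
  alternating_sq_le x := by simp [norm_smul, norm_unitStep]

/-- Two consecutive dyadic systems are joined into one by adding a common vector. -/
theorem IsDyadicSystem.glue {η : ℝ} (hη : 0 < η) (hη' : η ≤ 1 / 4) {n K L M : ℕ}
    {y z : ℕ → Lp ℝ 2 (volume : Measure ℝ)} (hy : IsDyadicSystem η n K L y)
    (hz : IsDyadicSystem η n L M z) :
    IsDyadicSystem η (n + 1) K (M + 1)
      (glue (2 ^ n) y z (√(((1 + η) / 2) ^ n * (η / 2)) • unitStep M)) := by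
  set q := ((1 + η) / 2) ^ n with hq
  have hq0 : 0 < q := by positivity
  -- With `s`, `t` the coefficient sums of the two halves, s² + t² ≥ (s + t)²/2. The common vector
  -- contributes a further (η/2)(s + t)², which turns the factor 1/2 into (1 + η)/2.
  have hw : √(q * (η / 2)) ^ 2 = q * (η / 2) := Real.sq_sqrt (by positivity)
  set w := √(q * (η / 2))
  have hqs : ((1 + η) / 2) ^ (n + 1) = q * ((1 + η) / 2) := pow_succ _ _
  have hyL : ∀ (p : ℕ) (x : ℕ → ℝ), ∑ j ∈ Finset.range p, x j • y j ∈ vanishingAbove L :=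
    fun p x => Submodule.sum_mem _ fun j _ => Submodule.smul_mem _ _ (hy.mem j)
  have hzM : ∀ (p : ℕ) (x : ℕ → ℝ), ∑ j ∈ Finset.range p, x j • z j ∈ vanishingAbove M :=
    fun p x => Submodule.sum_mem _ fun j _ => Submodule.smul_mem _ _ (hz.mem j)
  have hin : ∀ f ∈ vanishingAbove L, ∀ (p : ℕ) (x : ℕ → ℝ),
      inner ℝ f (∑ j ∈ Finset.range p, x j • z j) = 0 := by
    intro f hf p x
    rw [inner_sum]
    refine Finset.sum_eq_zero fun j _ => ?_
    rw [inner_smul_right, hz.inner_eq f hf, mul_zero]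
  have norm_left : ∀ p ≤ 2 ^ n, ∀ x : ℕ → ℝ,
      ‖∑ j ∈ Finset.range p, x j • _root_.glue (2 ^ n) y z (w • unitStep M) j‖ ^ 2 =
        ‖∑ j ∈ Finset.range p, x j • y j‖ ^ 2 +
          q * (η / 2) * (∑ j ∈ Finset.range p, x j) ^ 2 := by
    intro p hp x
    rw [sum_glue_of_le hp, smul_smul]
    have := norm_add_add_smul_unitStep_sq (vanishingAbove_mono hz.le (hyL p x))
      (Submodule.zero_mem (vanishingAbove M)) (inner_zero_right _)
      ((∑ j ∈ Finset.range p, x j) * w)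
    rw [add_zero] at this
    rw [this, norm_zero, mul_pow, hw]
    ring
  have norm_right : ∀ (p : ℕ) (x : ℕ → ℝ),
      ‖∑ j ∈ Finset.range (2 ^ n + p), x j • _root_.glue (2 ^ n) y z (w • unitStep M) j‖ ^ 2 =
        ‖∑ j ∈ Finset.range (2 ^ n), x j • y j‖ ^ 2 +
        ‖∑ j ∈ Finset.range p, x (2 ^ n + j) • z j‖ ^ 2 +
          q * (η / 2) * (∑ j ∈ Finset.range (2 ^ n), x j +
            ∑ j ∈ Finset.range p, x (2 ^ n + j)) ^ 2 := by
    intro p x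
    rw [sum_glue_add, smul_smul, norm_add_add_smul_unitStep_sq
      (vanishingAbove_mono hz.le (hyL (2 ^ n) x)) (hzM p _) (hin _ (hyL _ _) _ _), mul_pow, hw]
    ring
  have h2 : 2 ^ (n + 1) = 2 ^ n + 2 ^ n := by ring
  have h2' : (2 : ℝ) ^ (n + 1) = 2 ^ n + 2 ^ n := by ring
  constructor
  · exact hy.le.trans (hz.le.trans M.le_succ)
  · intro j
    refine add_nonneg ?_ (Lp_smul_nonneg (Real.sqrt_nonneg _) (unitStep_nonneg M))
    split_ifs
    · exact hy.nonneg j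
    · exact hz.nonneg _
  · intro j
    refine Submodule.add_mem _ (vanishingAbove_mono M.le_succ ?_)
      (Submodule.smul_mem _ _ (unitStep_mem M))
    split_ifs
    · exact vanishingAbove_mono hz.le (hy.mem j)
    · exact hz.mem _
  · intro f hf j
    have hf' := vanishingAbove_mono hy.le hf
    rw [_root_.glue, inner_add_right, inner_smul_right,
      inner_unitStep (vanishingAbove_mono hz.le hf'), mul_zero, add_zero]
    split_ifs
    · exact hy.inner_eq f hf j
    · exact hz.inner_eq f hf' _
  · intro x
    have e1 := hy.sum_sq_le x
    have e2 := hz.sum_sq_le fun j => x (2 ^ n + j)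
    rw [h2, norm_right, hqs, Finset.sum_range_add]
    set s := ∑ j ∈ Finset.range (2 ^ n), x j
    set t := ∑ j ∈ Finset.range (2 ^ n), x (2 ^ n + j)
    nlinarith [mul_nonneg hq0.le (sq_nonneg (s - t))]
  · intro x p hp
    rw [hqs]
    -- The extra term 3ηq(Σ x_j)² in the invariant pays for the common vector. In the first half,
    -- η/2 + 3η(1 + η)/2 ≤ 3η suffices.
    rcases le_total p (2 ^ n) with hp' | hp'
    · have e1 := hy.partial_le x p hp'
      rw [h2, norm_left p hp', norm_right]
      set s := ∑ j ∈ Finset.range p, x j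
      have e2 : 0 ≤ q * s ^ 2 := by positivity
      have e3 : 0 ≤ (1 + 12 * η) * (‖∑ j ∈ Finset.range (2 ^ n), x (2 ^ n + j) • z j‖ ^ 2 +
          q * (η / 2) * (∑ j ∈ Finset.range (2 ^ n), x j +
            ∑ j ∈ Finset.range (2 ^ n), x (2 ^ n + j)) ^ 2) := by positivity
      have e4 : 0 ≤ η * (2 - 3 * η) / 2 * (q * s ^ 2) :=
        mul_nonneg (by nlinarith) e2
      linarith
    · obtain ⟨r, rfl⟩ := Nat.exists_eq_add_of_le hp'
      have e1 := hz.partial_le (fun j => x (2 ^ n + j)) r (by omega)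
      have e2 := hy.sum_sq_le x
      rw [h2, norm_right, norm_right, Finset.sum_range_add]
      set s := ∑ j ∈ Finset.range (2 ^ n), x j
      set t := ∑ j ∈ Finset.range r, x (2 ^ n + j)
      have e3 : 0 ≤ (1 + 12 * η) * (q * (η / 2) * (s +
            ∑ j ∈ Finset.range (2 ^ n), x (2 ^ n + j)) ^ 2) := by positivity
      -- Here the whole first half is present, so 12η‖·‖² of it is available and dominates 12ηqs².
      -- By Cauchy–Schwarz (s + t)² ≤ (5/12)(12s² + 3t²), and 2 + 3η/2 ≤ 19/8 < 12/5.
      have e4 : (2 + 3 / 2 * η) * (s + t) ^ 2 ≤ 12 * s ^ 2 + 3 * t ^ 2 := by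
        nlinarith [sq_nonneg (s + t), sq_nonneg (19 * s - 5 * t), sq_nonneg s, sq_nonneg t]
      have e5 := mul_le_mul_of_nonneg_left e4 (mul_pos hη hq0).le
      have e6 := mul_le_mul_of_nonneg_left e2 hη.le
      linarith
  -- The number of vectors is even, so the common vector drops out of the alternating sum.
  · rw [h2, norm_right, ← Finset.sum_range_add, neg_one_geom_sum, if_pos (by simp), h2']
    have e1 := hy.norm_alternating_le
    have e2 := hz.norm_alternating_le
    have : ‖∑ j ∈ Finset.range (2 ^ n), (-1 : ℝ) ^ (2 ^ n + j) • z j‖ =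
        ‖∑ j ∈ Finset.range (2 ^ n), (-1 : ℝ) ^ j • z j‖ := by
      simp_rw [pow_add, mul_smul]
      rw [← Finset.smul_sum, norm_smul]
      simp
    rw [this]
    linarith
  · intro x
    have e1 := hy.alternating_sq_le x
    have e2 := hz.alternating_sq_le fun j => x (2 ^ n + j)
    rw [h2, norm_right, Finset.sum_range_add, h2']
    have : (∑ j ∈ Finset.range (2 ^ n), (-1 : ℝ) ^ (2 ^ n + j) * x (2 ^ n + j)) ^ 2 =
        (∑ j ∈ Finset.range (2 ^ n), (-1 : ℝ) ^ j * x (2 ^ n + j)) ^ 2 := by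
      simp_rw [pow_add, mul_assoc]
      rw [← Finset.mul_sum, mul_pow, ← pow_mul, (even_two.mul_left _).neg_one_pow, one_mul]
    have e3 : (0 : ℝ) ≤ 2 ^ n * (q * (η / 2) * (∑ j ∈ Finset.range (2 ^ n), x j +
            ∑ j ∈ Finset.range (2 ^ n), x (2 ^ n + j)) ^ 2) := by positivity
    rw [← this] at e2
    set s := ∑ j ∈ Finset.range (2 ^ n), (-1 : ℝ) ^ j * x j
    set t := ∑ j ∈ Finset.range (2 ^ n), (-1 : ℝ) ^ (2 ^ n + j) * x (2 ^ n + j)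
    nlinarith [sq_nonneg (s - t)]

theorem exists_isDyadicSystem {η : ℝ} (hη : 0 < η) (hη' : η ≤ 1 / 4) (n : ℕ) :
    ∀ K, ∃ K' y, IsDyadicSystem η n K K' y := by
  induction n with
  | zero => exact fun K => ⟨K + 1, _, isDyadicSystem_zero hη.le K⟩
  | succ n ih =>
    intro K
    obtain ⟨L, y, hy⟩ := ih K
    obtain ⟨M, z, hz⟩ := ih L
    exact ⟨M + 1, _, hy.glue hη hη' hz⟩

/-! ### Approximating one vector by a nonnegative block -/

/-- A finite-dimensional subspace can be extended by nonnegative vectors so that the distance to a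
unit vector `h` orthogonal to it decreases by a fixed factor, while the new vectors are almost
orthogonal to the subspace and have partial sum projections of norm close to `1`. -/
theorem exists_nonneg_extension {η δ τ : ℝ} (hη : 0 < η) (hη' : η ≤ 1 / 4) (hδ : 0 < δ)
    (hτ : 0 < τ) (hτ' : τ < 1) {K : ℕ} {F : Submodule ℝ (Lp ℝ 2 (volume : Measure ℝ))}
    (hF : F ≤ vanishingAbove K) {h : Lp ℝ 2 (volume : Measure ℝ)} (hh : h ∈ vanishingAbove K)
    (hnorm : ‖h‖ ≤ 1) (hFh : ∀ u ∈ F, inner ℝ u h = 0) :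
    ∃ (N K' : ℕ) (y : ℕ → Lp ℝ 2 (volume : Measure ℝ)), 0 < N ∧ K ≤ K' ∧
      (∀ j, 0 ≤ y j) ∧ (∀ j, y j ∈ vanishingAbove K') ∧ (∀ j < N, y j ≠ 0) ∧
      (∀ u ∈ F, ∀ x : ℕ → ℝ, ∀ m ≤ N, (1 - τ) * ‖u + ∑ j ∈ Finset.range m, x j • y j‖ ≤
        (1 + τ) * √((1 + δ ^ 2) * (1 + 12 * η)) * ‖u + ∑ j ∈ Finset.range N, x j • y j‖) ∧
      (∀ u ∈ F, ∀ x : ℕ → ℝ, (1 - τ) * ‖u‖ ≤ ‖u + ∑ j ∈ Finset.range N, x j • y j‖) ∧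
      ∃ x : ℕ → ℝ, ‖h - ∑ j ∈ Finset.range N, x j • y j‖ ^ 2 ≤ (1 + δ ^ 2)⁻¹ := by
  -- The depth makes the summing functional, scaled by `c`, at most `τ`. Depth `n + 1` ensures an
  -- even number of vectors.
  obtain ⟨n, hn⟩ : ∃ n, δ ^ 2 ≤ τ ^ 2 * (1 + η) ^ (n + 1) := by
    obtain ⟨n, hn⟩ := pow_unbounded_of_one_lt (δ ^ 2 / τ ^ 2) (by linarith : 1 < 1 + η)
    refine ⟨n, ?_⟩
    rw [div_lt_iff₀ (by positivity)] at hn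
    have : (1 + η) ^ n ≤ (1 + η) ^ (n + 1) := pow_le_pow_right₀ (by linarith) n.le_succ
    nlinarith [sq_nonneg τ]
  obtain ⟨K', d, hd⟩ := exists_isDyadicSystem hη hη' (n + 1) K
  set N := 2 ^ (n + 1) with hN
  have hN0 : (0 : ℝ) < 2 ^ (n + 1) := by positivity
  set s : ℝ := (√(2 ^ (n + 1)))⁻¹ with hs
  have hs0 : 0 < s := by positivity
  have hs2 : s ^ 2 * 2 ^ (n + 1) = 1 := by
    rw [hs, inv_pow, Real.sq_sqrt hN0.le, inv_mul_cancel₀ hN0.ne']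
  set c := δ * s with hc
  have hc0 : 0 < c := by positivity
  have hc2 : c ^ 2 * 2 ^ (n + 1) = δ ^ 2 := by rw [hc, mul_pow, mul_assoc, hs2, mul_one]
  clear_value c s
  let y : ℕ → Lp ℝ 2 (volume : Measure ℝ) := fun j => d j + c • ((-1 : ℝ) ^ j • h + |h|)
  have hsum : ∀ (m : ℕ) (x : ℕ → ℝ), ∑ j ∈ Finset.range m, x j • y j =
      ∑ j ∈ Finset.range m, x j • d j + (c * ∑ j ∈ Finset.range m, (-1) ^ j * x j) • h +
        (c * ∑ j ∈ Finset.range m, x j) • |h| := by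
    intro m x
    rw [Finset.mul_sum, Finset.mul_sum, Finset.sum_smul, Finset.sum_smul,
      ← Finset.sum_add_distrib, ← Finset.sum_add_distrib]
    refine Finset.sum_congr rfl fun j _ => ?_
    simp only [y, smul_add, smul_smul]
    rw [← add_assoc]
    congr 2
    · congr 1; ring
    · ring
  have hinner : ∀ f ∈ vanishingAbove K, ∀ (m : ℕ) (x : ℕ → ℝ),
      inner ℝ f (∑ j ∈ Finset.range m, x j • d j) = 0 := by
    intro f hf m x
    rw [inner_sum]
    refine Finset.sum_eq_zero fun j _ => ?_
    rw [inner_smul_right, hd.inner_eq f hf, mul_zero]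
  have halt : ∀ m ≤ N, ∀ x : ℕ → ℝ, (c * ∑ j ∈ Finset.range m, (-1) ^ j * x j) ^ 2 ≤
      δ ^ 2 * ‖∑ j ∈ Finset.range m, x j • d j‖ ^ 2 := by
    intro m hm x
    -- Truncated coefficients turn the bound for full sums into one for partial sums.
    have := hd.alternating_sq_le fun j => if j < m then x j else 0
    rw [← hN, sum_range_ite_smul hm] at this
    have e := sum_range_ite_smul hm x fun j => (-1 : ℝ) ^ j
    simp only [smul_eq_mul, mul_comm _ ((-1 : ℝ) ^ _)] at e
    rw [e] at this
    rw [mul_pow, ← hc2, mul_assoc]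
    gcongr
  have hflat : ∀ m ≤ N, ∀ x : ℕ → ℝ, |c * ∑ j ∈ Finset.range m, x j| ≤
      τ * ‖∑ j ∈ Finset.range m, x j • d j‖ := by
    intro m hm x
    have := hd.sum_sq_le fun j => if j < m then x j else 0
    rw [← hN, sum_range_ite_smul hm] at this
    have e := sum_range_ite_smul hm x fun _ => (1 : ℝ)
    simp only [smul_eq_mul, mul_one] at e
    rw [e, div_pow, div_mul_eq_mul_div, div_le_iff₀ hN0] at this
    apply abs_le_of_sq_le_sq _ (by positivity)
    have hp : (0 : ℝ) < (1 + η) ^ (n + 1) := by positivity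
    refine le_of_mul_le_mul_left ?_ hp
    calc (1 + η) ^ (n + 1) * (c * ∑ j ∈ Finset.range m, x j) ^ 2
        = c ^ 2 * ((1 + η) ^ (n + 1) * (∑ j ∈ Finset.range m, x j) ^ 2) := by ring
      _ ≤ c ^ 2 * (‖∑ j ∈ Finset.range m, x j • d j‖ ^ 2 * 2 ^ (n + 1)) := by gcongr
      _ = δ ^ 2 * ‖∑ j ∈ Finset.range m, x j • d j‖ ^ 2 := by rw [← hc2]; ring
      _ ≤ τ ^ 2 * (1 + η) ^ (n + 1) * ‖∑ j ∈ Finset.range m, x j • d j‖ ^ 2 := by gcongr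
      _ = (1 + η) ^ (n + 1) * (τ * ‖∑ j ∈ Finset.range m, x j • d j‖) ^ 2 := by ring
  have hpyth : ∀ u ∈ F, ∀ (m : ℕ) (x : ℕ → ℝ) (α : ℝ),
      ‖u + (∑ j ∈ Finset.range m, x j • d j + α • h)‖ ^ 2 =
        ‖u‖ ^ 2 + ‖∑ j ∈ Finset.range m, x j • d j‖ ^ 2 + α ^ 2 * ‖h‖ ^ 2 := by
    intro u hu m x α
    rw [norm_add_sq_real, norm_add_sq_real, inner_add_right, inner_smul_right, inner_smul_right,
      hFh u hu, hinner u (hF hu), real_inner_comm, hinner h hh, norm_smul, mul_pow,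
      Real.norm_eq_abs, sq_abs]
    ring
  -- Dropping the `|h|` term leaves a model whose three components are orthogonal, at a relative
  -- error of at most `τ`.
  have hnear : ∀ m ≤ N, ∀ u ∈ F, ∀ (x : ℕ → ℝ),
      |‖u + ∑ j ∈ Finset.range m, x j • y j‖ -
        ‖u + (∑ j ∈ Finset.range m, x j • d j +
          (c * ∑ j ∈ Finset.range m, (-1) ^ j * x j) • h)‖| ≤
      τ * ‖u + (∑ j ∈ Finset.range m, x j • d j +
          (c * ∑ j ∈ Finset.range m, (-1) ^ j * x j) • h)‖ := by
    intro m hm u hu x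
    refine (abs_norm_sub_norm_le _ _).trans ?_
    rw [hsum, ← add_assoc, add_sub_cancel_left, norm_smul, norm_abs_eq_norm, Real.norm_eq_abs]
    calc _ ≤ τ * ‖∑ j ∈ Finset.range m, x j • d j‖ * 1 := by
          gcongr
          exact hflat m hm x
      _ ≤ _ := by
          rw [mul_one]
          gcongr
          apply le_of_sq_le_sq _ (norm_nonneg _)
          rw [hpyth u hu]
          nlinarith [sq_nonneg ‖u‖, sq_nonneg ((c * ∑ j ∈ Finset.range m, (-1) ^ j * x j) * ‖h‖)]
  refine ⟨N, K', y, by positivity, hd.le, ?_, ?_, ?_, ?_, ?_, ?_⟩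
  · intro j
    refine add_nonneg (hd.nonneg j) (Lp_smul_nonneg hc0.le ?_)
    rcases neg_one_pow_eq_or ℝ j with e | e <;> rw [e]
    · rw [one_smul, add_comm]
      exact neg_le_iff_add_nonneg.1 (neg_le_abs h)
    · rw [neg_one_smul, neg_add_eq_sub, sub_nonneg]
      exact le_abs_self h
  · intro j
    have hh' := vanishingAbove_mono hd.le hh
    exact Submodule.add_mem _ (hd.mem j) (Submodule.smul_mem _ _ (Submodule.add_mem _
      (Submodule.smul_mem _ _ hh') (abs_mem_vanishingAbove hh')))
  -- Pairing with `d j` gives `‖d j‖ ^ 2`, which is nonzero since the alternating functional has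
  -- value ±1 on the `j`-th unit sequence.
  · intro j hj h0
    have h1 : inner ℝ (y j) (d j) = ‖d j‖ ^ 2 := by
      have h2 : c • ((-1 : ℝ) ^ j • h + |h|) ∈ vanishingAbove K :=
        Submodule.smul_mem _ _ (Submodule.add_mem _ (Submodule.smul_mem _ _ hh)
          (abs_mem_vanishingAbove hh))
      simp only [y]
      rw [inner_add_left, hd.inner_eq _ h2 j, real_inner_self_eq_norm_sq, add_zero]
    rw [h0, inner_zero_left] at h1
    have h2 := hd.alternating_sq_le (Pi.single j 1)
    have h3 : ∑ i ∈ Finset.range N, (Pi.single j 1 : ℕ → ℝ) i • d i = d j := by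
      rw [Finset.sum_eq_single_of_mem j (Finset.mem_range.2 hj)]
      · simp
      · intro i _ hi
        simp [hi]
    have h4 : ∑ i ∈ Finset.range N, (-1 : ℝ) ^ i * (Pi.single j 1 : ℕ → ℝ) i = (-1) ^ j := by
      rw [Finset.sum_eq_single_of_mem j (Finset.mem_range.2 hj)]
      · simp
      · intro i _ hi
        simp [hi]
    rw [← hN, h3, h4, ← h1, ← pow_mul, (even_two.mul_left _).neg_one_pow] at h2
    norm_num at h2
  · intro u hu x m hm
    have e1 := (abs_le.1 (hnear m hm u hu x)).2
    have e2 := (abs_le.1 (hnear N le_rfl u hu x)).1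
    have e3 : ‖u + (∑ j ∈ Finset.range m, x j • d j +
          (c * ∑ j ∈ Finset.range m, (-1) ^ j * x j) • h)‖ ≤ √((1 + δ ^ 2) * (1 + 12 * η)) *
        ‖u + (∑ j ∈ Finset.range N, x j • d j +
          (c * ∑ j ∈ Finset.range N, (-1) ^ j * x j) • h)‖ := by
      apply le_of_sq_le_sq _ (by positivity)
      rw [mul_pow, Real.sq_sqrt (by positivity), hpyth u hu, hpyth u hu]
      have f1 := halt m hm x
      have f2 := hd.partial_le x m hm
      set v := ‖∑ j ∈ Finset.range m, x j • d j‖ ^ 2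
      set V := ‖∑ j ∈ Finset.range N, x j • d j‖ ^ 2
      set α := (c * ∑ j ∈ Finset.range m, (-1) ^ j * x j) ^ 2
      set β := (c * ∑ j ∈ Finset.range N, (-1) ^ j * x j) ^ 2
      have hα : 0 ≤ α := sq_nonneg _
      have hβ : 0 ≤ β := sq_nonneg _
      have hv : v ≤ (1 + 12 * η) * V := by
        refine le_trans ?_ f2
        have : 0 ≤ 3 * η * ((1 + η) / 2) ^ (n + 1) * (∑ j ∈ Finset.range m, x j) ^ 2 := by
          positivity
        linarith
      have hh1 : ‖h‖ ^ 2 ≤ 1 := pow_le_one₀ (norm_nonneg _) hnorm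
      have hone : 1 ≤ (1 + δ ^ 2) * (1 + 12 * η) := by nlinarith [sq_nonneg δ]
      calc ‖u‖ ^ 2 + v + α * ‖h‖ ^ 2 ≤ ‖u‖ ^ 2 + v + δ ^ 2 * v := by
            have := mul_le_mul_of_nonneg_left hh1 hα
            linarith
        _ = ‖u‖ ^ 2 + (1 + δ ^ 2) * v := by ring
        _ ≤ (1 + δ ^ 2) * (1 + 12 * η) * ‖u‖ ^ 2 + (1 + δ ^ 2) * ((1 + 12 * η) * V) := by
            gcongr
            exact le_mul_of_one_le_left (sq_nonneg _) hone
        _ = (1 + δ ^ 2) * (1 + 12 * η) * (‖u‖ ^ 2 + V) := by ring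
        _ ≤ _ := by
            refine mul_le_mul_of_nonneg_left ?_ (by linarith)
            linarith [mul_nonneg hβ (sq_nonneg ‖h‖)]
    set X := ‖u + (∑ j ∈ Finset.range m, x j • d j +
          (c * ∑ j ∈ Finset.range m, (-1) ^ j * x j) • h)‖
    set Y := ‖u + (∑ j ∈ Finset.range N, x j • d j +
          (c * ∑ j ∈ Finset.range N, (-1) ^ j * x j) • h)‖
    calc (1 - τ) * ‖u + ∑ j ∈ Finset.range m, x j • y j‖
        ≤ (1 - τ) * ((1 + τ) * (√((1 + δ ^ 2) * (1 + 12 * η)) * Y)) := by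
          refine mul_le_mul_of_nonneg_left ?_ (by linarith)
          have := mul_le_mul_of_nonneg_left e3 (by linarith : 0 ≤ 1 + τ)
          linarith
      _ = (1 + τ) * √((1 + δ ^ 2) * (1 + 12 * η)) * ((1 - τ) * Y) := by ring
      _ ≤ _ := by
          gcongr
          linarith
  · intro u hu x
    have e2 := (abs_le.1 (hnear N le_rfl u hu x)).1
    have e3 : ‖u‖ ≤ ‖u + (∑ j ∈ Finset.range N, x j • d j +
          (c * ∑ j ∈ Finset.range N, (-1) ^ j * x j) • h)‖ := by
      apply le_of_sq_le_sq _ (norm_nonneg _)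
      rw [hpyth u hu]
      nlinarith [sq_nonneg ‖∑ j ∈ Finset.range N, x j • d j‖,
        sq_nonneg ((c * ∑ j ∈ Finset.range N, (-1) ^ j * x j) * ‖h‖)]
    nlinarith
  -- This θ minimizes (1 - θδ)² + θ², which bounds the squared distance from `h` to the multiple θs
  -- of the alternating sum of the block; the minimum is 1/(1 + δ²).
  · set θ := δ * (1 + δ ^ 2)⁻¹ with hθ
    have hθδ : 1 - θ * δ = (1 + δ ^ 2)⁻¹ := by
      rw [hθ]; field_simp; ring
    refine ⟨fun j => θ * s * (-1) ^ j, ?_⟩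
    have e1 : ∑ j ∈ Finset.range N, θ * s * (-1 : ℝ) ^ j = 0 := by
      rw [← Finset.mul_sum, neg_one_geom_sum, if_pos (by simp [hN, pow_succ]), mul_zero]
    have e2 : ∑ j ∈ Finset.range N, (-1 : ℝ) ^ j * (θ * s * (-1 : ℝ) ^ j) =
        2 ^ (n + 1) * (θ * s) := by
      have : ∀ j : ℕ, (-1 : ℝ) ^ j * (θ * s * (-1 : ℝ) ^ j) = θ * s := fun j => by
        rw [mul_left_comm, ← pow_add, Even.neg_one_pow ⟨j, rfl⟩, mul_one]
      simp [this, hN]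
    have e3 : ∑ j ∈ Finset.range N, (θ * s * (-1 : ℝ) ^ j) • d j =
        (θ * s) • ∑ j ∈ Finset.range N, (-1 : ℝ) ^ j • d j := by
      simp_rw [Finset.smul_sum, smul_smul]
    rw [hsum, e1, e2, e3, mul_zero, zero_smul, add_zero]
    have e4 : c * (2 ^ (n + 1) * (θ * s)) = θ * δ := by
      rw [hc]; linear_combination θ * δ * hs2
    have e5 : h - ((θ * s) • ∑ j ∈ Finset.range N, (-1 : ℝ) ^ j • d j + (θ * δ) • h) =
        (1 + δ ^ 2)⁻¹ • h - (θ * s) • ∑ j ∈ Finset.range N, (-1 : ℝ) ^ j • d j := by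
      rw [← hθδ, sub_smul, one_smul]; abel
    rw [e4, e5, norm_sub_sq_real, inner_smul_left, inner_smul_right, hinner h hh, norm_smul,
      norm_smul, mul_pow, mul_pow, Real.norm_eq_abs, sq_abs, Real.norm_eq_abs, sq_abs]
    have hh1 : ‖h‖ ^ 2 ≤ 1 := pow_le_one₀ (norm_nonneg _) hnorm
    have e6 := hd.norm_alternating_le
    have f1 := mul_le_mul_of_nonneg_left hh1 (sq_nonneg (1 + δ ^ 2)⁻¹)
    have f2 := mul_le_mul_of_nonneg_left e6 (sq_nonneg (θ * s))
    rw [mul_zero, mul_zero, mul_zero, sub_zero]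
    refine (add_le_add f1 f2).trans_eq ?_
    calc _ = ((1 + δ ^ 2)⁻¹) ^ 2 * 1 + (θ * s) ^ 2 * 2 ^ (n + 1) := rfl
      _ = ((1 + δ ^ 2)⁻¹) ^ 2 + θ ^ 2 := by linear_combination θ ^ 2 * hs2
      _ = (1 + δ ^ 2)⁻¹ := by
          rw [hθ]; field_simp

/-! ### Iterating the extension -/

/-- The vectors `x 0, …, x (n - 1)` are nonzero, nonnegative, supported below `K`, and their
partial sum projections have norm at most `C`. -/
structure IsNonnegSystem (C : ℝ) (K n : ℕ) (x : ℕ → Lp ℝ 2 (volume : Measure ℝ)) : Prop where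
  nonneg : ∀ j < n, 0 ≤ x j
  ne_zero : ∀ j < n, x j ≠ 0
  mem : ∀ j < n, x j ∈ vanishingAbove K
  partial_le : ∀ m ≤ n, ∀ a : ℕ → ℝ,
    ‖∑ j ∈ Finset.range m, a j • x j‖ ≤ C * ‖∑ j ∈ Finset.range n, a j • x j‖

/-- The block is built for the normalized residual of `f` modulo the current span. The constant may
grow by as little as desired because the block is almost orthogonal to that span and its own
constant is close to a number at most `C`. -/
theorem IsNonnegSystem.exists_extension {η δ C C' : ℝ} (hη : 0 < η) (hη' : η ≤ 1 / 4)
    (hδ : 0 < δ) (hC : √((1 + δ ^ 2) * (1 + 12 * η)) ≤ C) (hCC' : C < C') {K n : ℕ}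
    {x : ℕ → Lp ℝ 2 (volume : Measure ℝ)} (hx : IsNonnegSystem C K n x)
    {f : Lp ℝ 2 (volume : Measure ℝ)} {L : ℕ} (hf : f ∈ vanishingAbove L) :
    ∃ (n' K' : ℕ) (x' : ℕ → Lp ℝ 2 (volume : Measure ℝ)), n < n' ∧ (∀ j < n, x' j = x j) ∧
      IsNonnegSystem C' K' n' x' ∧ ∃ a : ℕ → ℝ, ∀ b : ℕ → ℝ,
        ‖f - ∑ j ∈ Finset.range n', a j • x' j‖ ≤
          √(1 + δ ^ 2)⁻¹ * ‖f - ∑ j ∈ Finset.range n, b j • x j‖ := by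
  have hC0 : 0 < C := lt_of_lt_of_le (Real.sqrt_pos.2 (by positivity)) hC
  have hC'0 : 0 < C' := hC0.trans hCC'
  -- Chosen so that (1 + τ)/(1 - τ) = C'/C.
  set τ := (C' - C) / (C + C') with hτdef
  have hτ : 0 < τ := div_pos (by linarith) (by linarith)
  have hτ1 : τ < 1 := (div_lt_one (by linarith)).2 (by linarith)
  have hτC : (1 + τ) * C = (1 - τ) * C' := by
    rw [hτdef]; field_simp; ring
  let F : Submodule ℝ (Lp ℝ 2 (volume : Measure ℝ)) :=
    Submodule.span ℝ (x '' Finset.range n)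
  have : FiniteDimensional ℝ F :=
    FiniteDimensional.span_of_finite ℝ ((Finset.range n).finite_toSet.image x)
  have hFmem : ∀ a : ℕ → ℝ, ∀ m ≤ n, ∑ j ∈ Finset.range m, a j • x j ∈ F := fun a m hm =>
    Submodule.sum_mem _ fun j hj => Submodule.smul_mem _ _ (Submodule.subset_span
      (Set.mem_image_of_mem x (Finset.range_mono hm hj)))
  have hFrep : ∀ u ∈ F, ∃ b : ℕ → ℝ, ∑ j ∈ Finset.range n, b j • x j = u := by
    intro u hu
    exact (Submodule.mem_span_image_finset_iff_exists_fun' ℝ).1 hu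
  have hFK : F ≤ vanishingAbove K := by
    refine Submodule.span_le.2 fun v hv => ?_
    obtain ⟨j, hj, rfl⟩ := hv
    exact hx.mem j (Finset.mem_range.1 hj)
  set r := f - F.starProjection f with hr
  have hrK : r ∈ vanishingAbove (max K L) := Submodule.sub_mem _
    (vanishingAbove_mono (le_max_right _ _) hf)
    (vanishingAbove_mono (le_max_left _ _) (hFK (F.starProjection_apply_mem f)))
  have hrF : ∀ u ∈ F, inner ℝ u r = 0 := fun u hu =>
    (Submodule.mem_orthogonal F r).1 (F.sub_starProjection_mem_orthogonal f) u hu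
  -- If `r = 0`, then `‖r‖⁻¹ = 0` and the block is built for the zero vector, which the norm bound
  -- `≤ 1` permits.
  have hrh : ‖r‖ • (‖r‖⁻¹ • r) = r := by
    rcases eq_or_ne r 0 with h0 | h0
    · simp [h0]
    · rw [smul_smul, mul_inv_cancel₀ (norm_ne_zero_iff.2 h0), one_smul]
  obtain ⟨N, K', y, hN, hK', hy0, hyK, hyne, hyb, hyu, t, ht⟩ :=
    exists_nonneg_extension (h := ‖r‖⁻¹ • r) hη hη' hδ hτ hτ1
      (hFK.trans (vanishingAbove_mono (le_max_left K L))) (Submodule.smul_mem _ _ hrK)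
      (by rw [norm_smul, norm_inv, norm_norm]; exact inv_mul_le_one)
      (fun u hu => by rw [inner_smul_right, hrF u hu, mul_zero])
  have hlt : ∀ j < n, glue n x y 0 j = x j := fun j hj => by rw [glue, if_pos hj, add_zero]
  have hge : ∀ j, n ≤ j → glue n x y 0 j = y (j - n) := fun j hj => by
    rw [glue, if_neg hj.not_gt, add_zero]
  have hsum : ∀ (p : ℕ) (a : ℕ → ℝ), ∑ j ∈ Finset.range (n + p), a j • glue n x y 0 j =
      ∑ j ∈ Finset.range n, a j • x j + ∑ j ∈ Finset.range p, a (n + j) • y j := by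
    intro p a
    rw [sum_glue_add, smul_zero, add_zero]
  refine ⟨n + N, K', glue n x y 0, by omega, hlt, ⟨?_, ?_, ?_, ?_⟩, ?_⟩
  · intro j hj
    rcases lt_or_ge j n with h | h
    · rw [hlt j h]; exact hx.nonneg j h
    · rw [hge j h]; exact hy0 _
  · intro j hj
    rcases lt_or_ge j n with h | h
    · rw [hlt j h]; exact hx.ne_zero j h
    · rw [hge j h]; exact hyne _ (by omega)
  · intro j hj
    rcases lt_or_ge j n with h | h
    · rw [hlt j h]
      exact vanishingAbove_mono ((le_max_left K L).trans hK') (hx.mem j h)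
    · rw [hge j h]; exact hyK _
  · intro m hm a
    have hτ' : 0 < 1 - τ := by linarith
    have e1 := hyu _ (hFmem a n le_rfl) fun j => a (n + j)
    refine le_of_mul_le_mul_left ?_ hτ'
    rw [hsum]
    set Z := ‖∑ j ∈ Finset.range n, a j • x j + ∑ j ∈ Finset.range N, a (n + j) • y j‖
    have hZ : 0 ≤ Z := norm_nonneg _
    rw [← mul_assoc, ← hτC]
    -- A cut inside the old system uses its constant `C` and the near-contractive projection onto
    -- `F`; a cut inside the new block uses the block's own bound.
    rcases le_total m n with h | h
    · rw [sum_glue_of_le h, smul_zero, add_zero]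
      have e2 := mul_le_mul_of_nonneg_left (hx.partial_le m h a) hτ'.le
      calc _ ≤ C * ((1 - τ) * ‖∑ j ∈ Finset.range n, a j • x j‖) := by linarith
        _ ≤ C * Z := by gcongr
        _ ≤ _ := by nlinarith [mul_nonneg (mul_pos hτ hC0).le hZ]
    · obtain ⟨p, rfl⟩ := Nat.exists_eq_add_of_le h
      rw [hsum]
      refine (hyb _ (hFmem a n le_rfl) (fun j => a (n + j)) p (by omega)).trans ?_
      gcongr
  · obtain ⟨b₀, hb₀⟩ := hFrep _ (F.starProjection_apply_mem f)
    refine ⟨fun j => if j < n then b₀ j else ‖r‖ * t (j - n), fun b => ?_⟩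
    have e1 : ∑ j ∈ Finset.range n, (if j < n then b₀ j else ‖r‖ * t (j - n)) • x j =
        F.starProjection f := by
      rw [← hb₀]
      refine Finset.sum_congr rfl fun j hj => ?_
      rw [if_pos (Finset.mem_range.1 hj)]
    have e2 : ∑ j ∈ Finset.range N,
        (if n + j < n then b₀ (n + j) else ‖r‖ * t (n + j - n)) • y j =
        ‖r‖ • ∑ j ∈ Finset.range N, t j • y j := by
      rw [Finset.smul_sum]
      refine Finset.sum_congr rfl fun j hj => ?_
      rw [if_neg (by omega), Nat.add_sub_cancel_left, mul_smul]
    rw [hsum, e1, e2, ← sub_sub, ← hr]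
    have e3 : r - ‖r‖ • ∑ j ∈ Finset.range N, t j • y j =
        ‖r‖ • (‖r‖⁻¹ • r - ∑ j ∈ Finset.range N, t j • y j) := by rw [smul_sub, hrh]
    -- The residual of the orthogonal projection realizes the distance to the span, so it beats
    -- every choice of `b`.
    have e4 : ‖r‖ ≤ ‖f - ∑ j ∈ Finset.range n, b j • x j‖ := by
      rw [hr, F.starProjection_minimal]
      exact ciInf_le ⟨0, by rintro _ ⟨_, rfl⟩; exact norm_nonneg _⟩
        (⟨_, hFmem b n le_rfl⟩ : F)
    rw [e3, norm_smul, norm_norm, mul_comm]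
    exact mul_le_mul (Real.le_sqrt_of_sq_le ht) e4 (norm_nonneg _) (Real.sqrt_nonneg _)

/-- An increasing chain of nonnegative systems, the `k`-th step of which brings the `k`-th term of
a prescribed sequence closer to the span. -/
theorem exists_chain_isNonnegSystem {η δ : ℝ} (hη : 0 < η) (hη' : η ≤ 1 / 4)
    (hδ : 0 < δ) {C : ℕ → ℝ} (hC : StrictMono C) (hC0 : √((1 + δ ^ 2) * (1 + 12 * η)) ≤ C 0)
    {f : ℕ → Lp ℝ 2 (volume : Measure ℝ)} (hf : ∀ k, ∃ L, f k ∈ vanishingAbove L) :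
    ∃ (n K : ℕ → ℕ) (x : ℕ → ℕ → Lp ℝ 2 (volume : Measure ℝ)), StrictMono n ∧
      (∀ k, ∀ j < n k, x (k + 1) j = x k j) ∧ (∀ k, IsNonnegSystem (C k) (K k) (n k) (x k)) ∧
      ∀ k, ∃ a : ℕ → ℝ, ∀ b : ℕ → ℝ,
        ‖f k - ∑ j ∈ Finset.range (n (k + 1)), a j • x (k + 1) j‖ ≤
          √(1 + δ ^ 2)⁻¹ * ‖f k - ∑ j ∈ Finset.range (n k), b j • x k j‖ := by
  let S : ℕ → Type := fun k => {s : ℕ × ℕ × (ℕ → Lp ℝ 2 (volume : Measure ℝ)) //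
    IsNonnegSystem (C k) s.2.1 s.1 s.2.2}
  have step : ∀ (k : ℕ) (s : S k), ∃ s' : S (k + 1), s.1.1 < s'.1.1 ∧
      (∀ j < s.1.1, s'.1.2.2 j = s.1.2.2 j) ∧ ∃ a : ℕ → ℝ, ∀ b : ℕ → ℝ,
        ‖f k - ∑ j ∈ Finset.range s'.1.1, a j • s'.1.2.2 j‖ ≤
          √(1 + δ ^ 2)⁻¹ * ‖f k - ∑ j ∈ Finset.range s.1.1, b j • s.1.2.2 j‖ := by
    rintro k ⟨⟨n, K, x⟩, hx⟩
    obtain ⟨L, hL⟩ := hf k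
    obtain ⟨n', K', x', h1, h2, h3, h4⟩ := hx.exists_extension hη hη' hδ
      (hC0.trans (hC.monotone k.zero_le)) (hC k.lt_succ_self) hL
    exact ⟨⟨⟨n', K', x'⟩, h3⟩, h1, h2, h4⟩
  choose g hg using step
  -- The chain starts from the empty system.
  let s₀ : S 0 := ⟨⟨0, 0, 0⟩, ⟨by simp, by simp, by simp, fun m hm a => by
    rw [Nat.le_zero.1 hm]; simp⟩⟩
  let s : ∀ k, S k := fun k => Nat.rec s₀ g k
  exact ⟨fun k => (s k).1.1, fun k => (s k).1.2.1, fun k => (s k).1.2.2,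
    strictMono_nat_of_lt_succ fun k => (hg k (s k)).1, fun k => (hg k (s k)).2.1,
    fun k => (s k).2, fun k => (hg k (s k)).2.2⟩

/-- `A` bounds the constant of each block, and the gap up to `B` absorbs the infinitely many small
losses from appending blocks. -/
theorem exists_isCBasic_nonneg_dense {A B : ℝ} (hA : 1 < A) (hAB : A < B) :
    ∃ x : ℕ → Lp ℝ 2 (volume : Measure ℝ), (∀ j, 0 ≤ x j) ∧ (∀ j, x j ≠ 0) ∧
      IsCBasic ℝ B x ∧ Dense (Submodule.span ℝ (Set.range x) : Set (Lp ℝ 2 (volume : Measure ℝ))) := by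
  obtain ⟨η, hη, hη', hηA⟩ : ∃ η : ℝ, 0 < η ∧ η ≤ 1 / 4 ∧ 1 + 12 * η ≤ A := by
    refine ⟨min (1 / 4) ((A - 1) / 12), lt_min (by norm_num) (by linarith), min_le_left _ _, ?_⟩
    linarith [min_le_right (1 / 4) ((A - 1) / 12)]
  -- With δ² = 12η the block constant is exactly 1 + 12η.
  have hδ : 0 < √(12 * η) := Real.sqrt_pos.2 (by positivity)
  have hsq : √((1 + √(12 * η) ^ 2) * (1 + 12 * η)) ≤ A := by
    rw [Real.sq_sqrt (by positivity), Real.sqrt_mul_self (by positivity)]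
    exact hηA
  set δ := √(12 * η)
  have : Fact ((2 : ENNReal) ≠ ⊤) := ⟨by norm_num⟩
  obtain ⟨D, hDsub, hDc, hDd⟩ := dense_iUnion_vanishingAbove.exists_countable_dense_subset
  obtain ⟨q, rfl⟩ := hDc.exists_eq_range hDd.nonempty
  have hq : ∀ i, ∃ L, q i ∈ vanishingAbove L := fun i =>
    Set.mem_iUnion.1 (hDsub (Set.mem_range_self i))
  let C : ℕ → ℝ := fun k => B - (B - A) / (k + 1)
  have hC : StrictMono C := strictMono_nat_of_lt_succ fun k => by
    apply sub_lt_sub_left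
    apply div_lt_div_of_pos_left (by linarith) (by positivity)
    push_cast
    linarith
  have hCB : ∀ k, C k ≤ B := fun k =>
    sub_le_self _ (div_nonneg (by linarith) (by positivity))
  -- The first component of `Nat.unpair` takes every value infinitely often, so each `q i` is
  -- treated infinitely often.
  obtain ⟨n, K, x, hn, hagree, hsys, happrox⟩ := exists_chain_isNonnegSystem hη hη' hδ hC
    (by simpa [C] using hsq) (f := fun k => q k.unpair.1) (fun k => hq _)
  have hagree' : ∀ k l, k ≤ l → ∀ j < n k, x l j = x k j := by
    intro k l hkl
    induction l, hkl using Nat.le_induction with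
    | base => exact fun _ _ => rfl
    | succ l hkl ih => exact fun j hj =>
        (hagree l j (hj.trans_le (hn.monotone hkl))).trans (ih j hj)
  -- Diagonal choice: `n` is strictly increasing, so stage `j + 1` already contains index `j`, which
  -- is never changed afterwards.
  let X : ℕ → Lp ℝ 2 (volume : Measure ℝ) := fun j => x (j + 1) j
  have hjn : ∀ j, j < n (j + 1) := fun j => (Nat.lt_succ_self j).trans_le (hn.id_le (j + 1))
  have hX : ∀ k, ∀ j < n k, X j = x k j := by
    intro k j hj
    rcases le_total k (j + 1) with h | h
    · exact hagree' _ _ h j hj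
    · exact (hagree' _ _ h j (hjn j)).symm
  have hXsum : ∀ k, ∀ m ≤ n k, ∀ a : ℕ → ℝ, ∑ j ∈ Finset.range m, a j • X j =
      ∑ j ∈ Finset.range m, a j • x k j := fun k m hm a =>
    Finset.sum_congr rfl fun j hj => by rw [hX k j ((Finset.mem_range.1 hj).trans_le hm)]
  refine ⟨X, fun j => (hsys (j + 1)).nonneg j (hjn j), fun j => (hsys (j + 1)).ne_zero j (hjn j),
    ⟨by linarith, ?_⟩, ?_⟩
  · intro m p hmp a
    have hp : p ≤ n p := hn.id_le p
    have := (hsys p).partial_le m (hmp.trans hp) fun j => if j < p then a j else 0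
    rw [sum_range_ite_smul hp, ← hXsum p p hp, ← hXsum p m (hmp.trans hp)] at this
    have e : ∑ j ∈ Finset.range m, (if j < p then a j else 0) • X j =
        ∑ j ∈ Finset.range m, a j • X j := Finset.sum_congr rfl fun j hj => by
      rw [if_pos ((Finset.mem_range.1 hj).trans_le hmp)]
    rw [e] at this
    exact this.trans (mul_le_mul_of_nonneg_right (hCB p) (norm_nonneg _))
  · set ρ := √(1 + δ ^ 2)⁻¹ with hρ
    have hρ0 : 0 ≤ ρ := Real.sqrt_nonneg _
    have hρ1 : ρ < 1 := by
      rw [hρ, Real.sqrt_lt' one_pos, one_pow]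
      exact inv_lt_one_of_one_lt₀ (by linarith [pow_pos hδ 2])
    -- Step `Nat.pair i k` targets `q i` and comes no earlier than stage `k`, so the approximation
    -- found at stage `k` is still available and improves by the factor `ρ`.
    have hdist : ∀ i M, ∃ (k : ℕ) (a : ℕ → ℝ),
        ‖q i - ∑ j ∈ Finset.range (n k), a j • X j‖ ≤ ρ ^ M * ‖q i‖ := by
      intro i M
      induction M with
      | zero => exact ⟨0, 0, by simp⟩
      | succ M ih =>
        obtain ⟨k, a, ha⟩ := ih
        have hk : n k ≤ n (Nat.pair i k) := hn.monotone (Nat.right_le_pair i k)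
        obtain ⟨b, hb⟩ := happrox (Nat.pair i k)
        refine ⟨Nat.pair i k + 1, b, ?_⟩
        have := hb fun j => if j < n k then a j else 0
        rw [← hXsum _ _ le_rfl, ← hXsum _ _ le_rfl, sum_range_ite_smul hk, Nat.unpair_pair] at this
        refine this.trans ?_
        rw [pow_succ', mul_assoc]
        exact mul_le_mul_of_nonneg_left ha hρ0
    rw [← dense_closure]
    refine hDd.mono ?_
    rintro _ ⟨i, rfl⟩
    rw [Metric.mem_closure_iff]
    intro r hr
    have hlim : Tendsto (fun M => ρ ^ M * ‖q i‖) atTop (𝓝 0) := by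
      simpa using (tendsto_pow_atTop_nhds_zero_of_lt_one hρ0 hρ1).mul_const ‖q i‖
    obtain ⟨M, hM⟩ := (hlim.eventually_lt_const hr).exists
    obtain ⟨k, a, ha⟩ := hdist i M
    exact ⟨_, mem_span_range_iff_exists_sum_range.2 ⟨n k, a, rfl⟩, by
      rw [dist_eq_norm]; exact ha.trans_lt hM⟩

theorem theorem2p2 (ε : ℝ) (hε : 0 < ε) :
    ∃ b : SchauderBasis ℝ (Lp ℝ 2 (volume : Measure ℝ)),
      (∀ n : ℕ, ∀ᵐ t : ℝ, 0 ≤ (b.basis n : ℝ → ℝ) t) ∧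
      ∃ C : ℝ, IsBasisConstant ℝ C b.basis ∧ C ≤ 1 + ε := by
  obtain ⟨x, hx0, hxne, hbasic, hdense⟩ :=
    exists_isCBasic_nonneg_dense (A := 1 + ε / 2) (B := 1 + ε) (by linarith) (by linarith)
  obtain ⟨b, rfl⟩ := hbasic.exists_schauderBasis hxne hdense
  exact ⟨b, fun n => (Lp.coeFn_nonneg _).2 (hx0 n), hbasic.exists_isBasisConstant (hxne 0)⟩
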